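/- Let $K$ be a field, $n\ge 1$, $R=K[X_1,\dots,X_n]$ and $\mathfrak m=(X_1,\dots,X_n)\subset R$. Consider on $R$ (and on $\mathfrak m$) the standard $\mathbb Z$-grading with $\deg X_i=1$ (indicated by the index $1$) and the $\mathbb Z^n$-grading with $\deg X_i=e_i$ (indicated by the index $n$). In either case, a graded retract of $R$ is a subalgebra $S\subset R$ for which there is a degree-preserving $K$-algebra homomorphism $\pi:R\to S$ with $\pi|_S=\mathrm{id}$; it is a polynomial ring over $K$. For a finitely generated graded $R$-module $M$: - A *Stanley decomposition* of $M$ is a finite family $(S_i,x_i)_{i\in I}$ of graded retracts $S_i$ of $R$ and homogeneous elements $x_i\in M$ such that $S_i\cap\operatorname{Ann}x_i=0$ for all $i$ and $M=\bigoplus_{i\in I}S_ix_i$ as a graded $K$-vector space. - A *Hilbert decomposition* of $M$ is a finite family $(S_i,s_i)_{i\in I}$ of graded retracts $S_i$ of $R$ and degrees $s_i$ such that $M\cong\bigoplus_{i\in I}S_i(-s_i)$ as a graded $K$-vector space. - The *depth* of such a decomposition is $\min_{i\in I}\dim S_i$, where $\dim S_i$ is the Krull dimension, that is, the number of variables of the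 polynomial ring $S_i$. - The *Stanley depth* $\operatorname{Stdepth}M$ and the *Hilbert depth* $\operatorname{Hdepth}M$ are the maximal depths of a Stanley decomposition and of a Hilbert decomposition of $M$, respectively. Then $$\operatorname{Hdepth}_1\mathfrak m=\operatorname{Hdepth}_n\mathfrak m=\operatorname{Stdepth}_n\mathfrak m=\left\lfloor\frac{n+1}{2}\right\rfloor .$$ -/

import Mathlib

open scoped DirectSum

noncomputable section

namespace StanleyHilbert

variable {K : Type*} [Field K] {n : ℕ} {G : Type*} [AddCommGroup G]

/-- The degrees of the indeterminates in the standard grading of `K[X_1, …, X_n]`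
over `ℤ`: each `X_i` has degree `1`. -/
def standardDegree (n : ℕ) : Fin n → ℤ := fun _ => 1

/-- The degrees of the indeterminates in the multigrading of `K[X_1, …, X_n]`
over `ℤ^n`: the degree of `X_i` is the `i`-th canonical basis vector. -/
def multiDegree (n : ℕ) : Fin n → (Fin n → ℤ) := fun i => Pi.single i 1

/-- The component `R_g` of the polynomial ring `R = K[X_1, …, X_n]`, graded by giving `X_i`
the degree `w i`. -/
def ringGrading (K : Type*) [Field K] (w : Fin n → G) (g : G) :
    Submodule K (MvPolynomial (Fin n) K) :=
  MvPolynomial.weightedHomogeneousSubmodule K w g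

/-- `S` is a graded retract of `R`: there is a degree-preserving `K`-algebra homomorphism
`π : R → S` that restricts to the identity of `S`. (Such a `π` is onto, and `S` is then a graded
subalgebra: the homogeneous components of `f = π f` are the images of those of `f`.) -/
def IsGradedRetract (w : Fin n → G) (S : Subalgebra K (MvPolynomial (Fin n) K)) : Prop :=
  ∃ π : MvPolynomial (Fin n) K →ₐ[K] S,
    (∀ (g : G) (f : MvPolynomial (Fin n) K),
      f ∈ ringGrading K w g → (π f : MvPolynomial (Fin n) K) ∈ ringGrading K w g) ∧
    ∀ s : S, π (s : MvPolynomial (Fin n) K) = s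

section Modules

variable {M : Type*} [AddCommGroup M] [Module K M] [Module (MvPolynomial (Fin n) K) M]
  [IsScalarTower K (MvPolynomial (Fin n) K) M]

/-- The `K`-subspace `S x = {a x : a ∈ S}` of the `R`-module `M`. -/
def cyclicPart (S : Subalgebra K (MvPolynomial (Fin n) K)) (x : M) : Submodule K M :=
  (Subalgebra.toSubmodule S).map
    ((LinearMap.toSpanSingleton (MvPolynomial (Fin n) K) M x).restrictScalars K)

/-- A Stanley decomposition of the graded `R`-module `M = ⨁_g ℳ g`: a finite family
`(S_i, x_i)` of graded retracts `S_i` of `R` and homogeneous elements `x_i` of `M` such that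
`S_i ∩ Ann x_i = 0` and `M = ⨁_i S_i x_i`. (The subspaces `S_i x_i` are automatically graded.) -/
structure StanleyDecomposition (w : Fin n → G) (ℳ : G → Submodule K M) where
  /-- the number of summands -/
  size : ℕ
  /-- the retracts -/
  S : Fin size → Subalgebra K (MvPolynomial (Fin n) K)
  /-- the generators -/
  x : Fin size → M
  isGradedRetract : ∀ i, IsGradedRetract w (S i)
  homogeneous : ∀ i, ∃ g, x i ∈ ℳ g
  inter_ann : ∀ i, ∀ a ∈ S i, a • x i = 0 → a = 0
  isInternal : DirectSum.IsInternal fun i => cyclicPart (S i) (x i)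

/-- A Hilbert decomposition of the graded `R`-module `M = ⨁_g ℳ g`: a finite family
`(S_i, s_i)` of graded retracts `S_i` of `R` and degrees `s_i` such that
`M ≅ ⨁_i S_i(-s_i)` as graded `K`-vector spaces, where `S_i(-s_i)_g = (S_i)_{g - s_i}`. -/
structure HilbertDecomposition (w : Fin n → G) (ℳ : G → Submodule K M) where
  /-- the number of summands -/
  size : ℕ
  /-- the retracts -/
  S : Fin size → Subalgebra K (MvPolynomial (Fin n) K)
  /-- the shifts -/
  s : Fin size → G
  isGradedRetract : ∀ i, IsGradedRetract w (S i)
  exists_iso : ∃ φ : M ≃ₗ[K] ⨁ i, S i, ∀ (g : G) (m : M),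
    m ∈ ℳ g ↔ ∀ i, ((φ m) i : MvPolynomial (Fin n) K) ∈ ringGrading K w (g - s i)

/-- The depth of a Stanley decomposition: the least dimension (number of variables) of the
polynomial rings `S_i` in it; it is `∞` for the empty family. -/
def StanleyDecomposition.depth {w : Fin n → G} {ℳ : G → Submodule K M}
    (D : StanleyDecomposition w ℳ) : WithBot ℕ∞ :=
  ⨅ i, ringKrullDim (D.S i)

/-- The depth of a Hilbert decomposition: the least dimension (number of variables) of the
polynomial rings `S_i` in it; it is `∞` for the empty family. -/
def HilbertDecomposition.depth {w : Fin n → G} {ℳ : G → Submodule K M}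
    (D : HilbertDecomposition w ℳ) : WithBot ℕ∞ :=
  ⨅ i, ringKrullDim (D.S i)

/-- The Stanley depth: the maximal depth of a Stanley decomposition
(`⊥` if there is no decomposition). -/
def stanleyDepth (w : Fin n → G) (ℳ : G → Submodule K M) : WithBot ℕ∞ :=
  ⨆ D : StanleyDecomposition w ℳ, D.depth

/-- The Hilbert depth: the maximal depth of a Hilbert decomposition
(`⊥` if there is no decomposition). -/
def hilbertDepth (w : Fin n → G) (ℳ : G → Submodule K M) : WithBot ℕ∞ :=
  ⨆ D : HilbertDecomposition w ℳ, D.depth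

end Modules

/-- The ideal `𝔪 = (X_1, …, X_n)` of `K[X_1, …, X_n]`. -/
def maxIdeal (K : Type*) [Field K] (n : ℕ) : Ideal (MvPolynomial (Fin n) K) :=
  Ideal.span (Set.range MvPolynomial.X)

/-- The grading that an ideal `I` inherits from `R`: `I_g = I ∩ R_g`. -/
def idealGrading (w : Fin n → G) (I : Ideal (MvPolynomial (Fin n) K)) (g : G) :
    Submodule K I :=
  (ringGrading K w g).comap (I.subtype.restrictScalars K)

end StanleyHilbert

end

/-! The three depths satisfy `Stdepth_n ≤ Hdepth_n ≤ Hdepth_1`: multiplication by the generators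
turns Stanley into Hilbert decompositions, and summing coordinates coarsens the grading. It remains
to bound the first from below and the last from above.

Lower bound: if the nonempty subsets of `Fin n` are partitioned into intervals `[A, B]`, then 𝔪 is
the direct sum of the spaces `X^A K[X_i : i ∈ B]`. For `exists_interval_partition`, a nonempty `C`
is read around a cycle of odd length `n` or `n + 1`, and a bit `z` is set to `false` after each
element of `C` and flipped otherwise. The sets with the same `z` form an interval: `z` forces
membership after `false, false`, forbids it before `true`, and leaves it free at `true, false`. No
two cyclically adjacent bits are `true`, so at most `n / 2` elements are missing from the upper end.

Upper bound: all shifts are at least 1, and degree 1 forces at least `n` summands with shift 1.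
Their linear forms inject into degree 2, of dimension `n (n + 1) / 2`, so one of these summands has
at most `(n + 1) / 2` independent linear forms, and these generate it. -/

open scoped DirectSum

noncomputable section

namespace StanleyHilbert

/-! ### Interval partitions of the nonempty subsets. -/

/-- The Boolean sequence with initial value `b` that is reset to `false` after each
index selected by `c` and alternates otherwise. -/
def resetSeq (c : ℕ → Bool) (b : Bool) : ℕ → Bool
  | 0 => b
  | i + 1 => !c i && !resetSeq c b i

/-- `z` is a reset sequence for `c` on the cycle of length `N`. -/
def IsCyclicReset (c : ℕ → Bool) (N : ℕ) (z : ℕ → Bool) : Prop :=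
  (∀ i < N, z (i + 1) = (!c i && !z i)) ∧ z N = z 0

lemma resetSeq_eq_of_lt {c : ℕ → Bool} {i : ℕ} (hc : c i = true) (b b' : Bool) {m : ℕ}
    (hm : i < m) : resetSeq c b m = resetSeq c b' m := by
  induction m with
  | zero => omega
  | succ m ih =>
    rcases Nat.lt_succ_iff_lt_or_eq.1 hm with h | rfl
    · simp [resetSeq, ih h]
    · simp [resetSeq, hc]

/-- After a reset the initial bit is forgotten, so the final bit of one turn can serve as the
initial bit of the next. -/
lemma exists_isCyclicReset {c : ℕ → Bool} {N i : ℕ} (hi : i < N) (hc : c i = true) :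
    ∃ z, IsCyclicReset c N z :=
  ⟨resetSeq c (resetSeq c false N), fun _ _ => rfl, resetSeq_eq_of_lt hc _ _ hi⟩

/-- Agreement starts just after the reset at `i`, runs to `N`, passes to `0` through the closing
condition, and then propagates to every index. -/
lemma IsCyclicReset.eq {c : ℕ → Bool} {N i : ℕ} (hi : i < N) (hc : c i = true) {z z' : ℕ → Bool}
    (hz : IsCyclicReset c N z) (hz' : IsCyclicReset c N z') {j : ℕ} (hj : j ≤ N) :
    z j = z' j := by
  have key : ∀ m, i < m → m ≤ N → z m = z' m := by
    intro m
    induction m with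
    | zero => omega
    | succ m ih =>
      intro h hm
      rw [hz.1 m (by omega), hz'.1 m (by omega)]
      rcases Nat.lt_succ_iff_lt_or_eq.1 h with h | rfl
      · rw [ih h (by omega)]
      · simp [hc]
  have h0 : z 0 = z' 0 := by rw [← hz.2, ← hz'.2, key N hi le_rfl]
  induction j with
  | zero => exact h0
  | succ j ih => rw [hz.1 j (by omega), hz'.1 j (by omega), ih (by omega)]

/-- `z i` and `z (i + 1)` are never both true; by cyclicity both sums over one turn count the same
bits. -/
lemma IsCyclicReset.two_mul_card_le {c : ℕ → Bool} {N : ℕ} {z : ℕ → Bool}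
    (hz : IsCyclicReset c N z) :
    2 * ((Finset.range N).filter fun i => z (i + 1) = true).card ≤ N := by
  have h1 : ∑ i ∈ Finset.range N, (if z (i + 1) = true then 1 else 0)
      = ∑ i ∈ Finset.range N, (if z i = true then 1 else 0) := by
    have h := Finset.sum_range_succ (fun i => if z i = true then 1 else 0) N
    rw [Finset.sum_range_succ', hz.2] at h
    exact Nat.add_right_cancel h
  have h2 : ∑ i ∈ Finset.range N,
      ((if z (i + 1) = true then 1 else 0) + (if z i = true then 1 else 0))
        ≤ ∑ i ∈ Finset.range N, 1 := by
    refine Finset.sum_le_sum fun i hi => ?_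
    rw [hz.1 i (Finset.mem_range.1 hi)]
    cases c i <;> cases z i <;> simp
  rw [Finset.sum_add_distrib, ← h1] at h2
  simp only [Finset.sum_const, Finset.card_range, smul_eq_mul, mul_one] at h2
  rw [Finset.card_filter]
  omega

/-- The indicator function on `ℕ` of a set of elements of `Fin n`. -/
def natIndicator {n : ℕ} (C : Finset (Fin n)) (i : ℕ) : Bool :=
  decide (∃ h : i < n, (⟨i, h⟩ : Fin n) ∈ C)

lemma natIndicator_fin {n : ℕ} (C : Finset (Fin n)) (i : Fin n) :
    natIndicator C i = true ↔ i ∈ C := by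
  simp [natIndicator]

lemma natIndicator_of_le {n : ℕ} (C : Finset (Fin n)) {i : ℕ} (h : n ≤ i) :
    natIndicator C i = false := by
  simp [natIndicator, h]

/-- The lower end of the interval attached to a cyclic reset sequence. -/
def resetLower (n : ℕ) (z : ℕ → Bool) : Finset (Fin n) :=
  Finset.univ.filter fun i => z i = false ∧ z (i + 1) = false

/-- The upper end of the interval attached to a cyclic reset sequence. -/
def resetUpper (n : ℕ) (z : ℕ → Bool) : Finset (Fin n) :=
  Finset.univ.filter fun i => z (i + 1) = false

lemma IsCyclicReset.le_card_resetUpper {c : ℕ → Bool} {n : ℕ} {z : ℕ → Bool}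
    -- The length is the odd one among `n` and `n + 1`. At most `n / 2` of its bits are true, which
    -- leaves `n - n / 2 = (n + 1) / 2`.
    (hz : IsCyclicReset c (2 * (n / 2) + 1) z) : (n + 1) / 2 ≤ (resetUpper n z).card := by
  have h1 := hz.two_mul_card_le
  have h2 := Finset.card_filter_add_card_filter_not (s := (Finset.univ : Finset (Fin n)))
    (fun i => z (i + 1) = false)
  have h3 : (Finset.univ.filter fun i : Fin n => ¬ z (i + 1) = false).card
      ≤ ((Finset.range (2 * (n / 2) + 1)).filter fun i => z (i + 1) = true).card := by
    refine Finset.card_le_card_of_injOn (fun i => (i : ℕ)) (fun i hi => ?_)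
      (fun i _ j _ h => Fin.ext h)
    have := i.2
    simp only [Finset.coe_filter, Finset.mem_univ, true_and, Set.mem_ofPred_eq,
      Bool.not_eq_false, Finset.mem_range] at hi ⊢
    exact ⟨by omega, hi⟩
  rw [Finset.card_univ, Fintype.card_fin] at h2
  unfold resetUpper
  omega

lemma IsCyclicReset.resetLower_subset {n N : ℕ} {C : Finset (Fin n)} {z : ℕ → Bool}
    (hN : n ≤ N) (hz : IsCyclicReset (natIndicator C) N z) : resetLower n z ⊆ C := by
  intro i hi
  simp only [resetLower, Finset.mem_filter, Finset.mem_univ, true_and] at hi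
  have := hz.1 i (by omega)
  rw [hi.1, hi.2] at this
  rw [← natIndicator_fin]
  simpa using this

lemma IsCyclicReset.subset_resetUpper {n N : ℕ} {C : Finset (Fin n)} {z : ℕ → Bool}
    (hN : n ≤ N) (hz : IsCyclicReset (natIndicator C) N z) : C ⊆ resetUpper n z := by
  intro i hi
  simp only [resetUpper, Finset.mem_filter, Finset.mem_univ, true_and]
  rw [hz.1 i (by omega), (natIndicator_fin C i).2 hi]
  rfl

/-- With an empty lower end the bits would alternate all around a cycle of odd length. A padding
index beyond `Fin n` is never selected, so it flips as well. -/
lemma IsCyclicReset.resetLower_nonempty {n k : ℕ} {C : Finset (Fin n)} {z : ℕ → Bool}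
    (hz : IsCyclicReset (natIndicator C) (2 * k + 1) z) : (resetLower n z).Nonempty := by
  by_contra hne
  rw [Finset.not_nonempty_iff_eq_empty] at hne
  have hstep : ∀ i < 2 * k + 1, z (i + 1) = !z i := by
    intro i hi
    have h := hz.1 i hi
    by_cases hin : i < n
    · have hmem : (⟨i, hin⟩ : Fin n) ∉ resetLower n z := by simp [hne]
      simp only [resetLower, Finset.mem_filter, Finset.mem_univ, true_and] at hmem
      revert h hmem
      cases z i <;> cases z (i + 1) <;> simp
    · rw [h, natIndicator_of_le C (not_lt.1 hin)]
      rfl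
  have heven : ∀ j ≤ k, z (2 * j) = z 0 := by
    intro j
    induction j with
    | zero => simp
    | succ j ih =>
      intro hj
      rw [show 2 * (j + 1) = 2 * j + 1 + 1 by ring, hstep _ (by omega), hstep _ (by omega),
        ih (by omega), Bool.not_not]
  have h := hz.2
  rw [hstep _ (by omega), heven k le_rfl] at h
  revert h
  cases z 0 <;> simp

/-- The endpoints record everything `z` demands of a set, so the interval is contained in the fibre
of `z`. With uniqueness of `z` this makes distinct intervals disjoint. -/
lemma IsCyclicReset.of_mem_interval {n N : ℕ} {C C' : Finset (Fin n)} {z : ℕ → Bool}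
    (hz : IsCyclicReset (natIndicator C) N z)
    (hl : resetLower n z ⊆ C') (hu : C' ⊆ resetUpper n z) :
    IsCyclicReset (natIndicator C') N z := by
  refine ⟨fun i hi => ?_, hz.2⟩
  have h := hz.1 i hi
  by_cases hin : i < n
  · have hl' := @hl ⟨i, hin⟩
    have hu' := @hu ⟨i, hin⟩
    simp only [resetLower, resetUpper, Finset.mem_filter, Finset.mem_univ, true_and] at hl' hu'
    rw [← natIndicator_fin] at hl' hu'
    revert h hl' hu'
    simp only
    cases z i <;> cases z (i + 1) <;> cases natIndicator C' i <;> simp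
  · rw [h, natIndicator_of_le C (not_lt.1 hin), natIndicator_of_le C' (not_lt.1 hin)]

/-- The nonempty subsets of `Fin n` can be partitioned into intervals whose upper ends have at
least `⌊(n + 1) / 2⌋` elements. -/
theorem exists_interval_partition (n : ℕ) :
    ∃ (m : ℕ) (A B : Fin m → Finset (Fin n)),
      (∀ i, (A i).Nonempty ∧ A i ⊆ B i ∧ (n + 1) / 2 ≤ (B i).card) ∧
      ∀ C : Finset (Fin n), C.Nonempty → ∃! i, A i ⊆ C ∧ C ⊆ B i := by
  have hN : n ≤ 2 * (n / 2) + 1 := by omega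
  have hex : ∀ C : Finset (Fin n), C.Nonempty →
      ∃ z, IsCyclicReset (natIndicator C) (2 * (n / 2) + 1) z := by
    rintro C ⟨i, hi⟩
    exact exists_isCyclicReset (i := i) (by omega) ((natIndicator_fin C i).2 hi)
  -- Indexing by the pairs of endpoints, not by `C`, counts each interval once.
  let P : Set (Finset (Fin n) × Finset (Fin n)) :=
    {p | ∃ (C : Finset (Fin n)) (z : ℕ → Bool), IsCyclicReset (natIndicator C) (2 * (n / 2) + 1) z ∧
      p = (resetLower n z, resetUpper n z)}
  have hfin : Finite P := Subtype.finite
  obtain ⟨m, ⟨e⟩⟩ := Finite.exists_equiv_fin P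
  refine ⟨m, fun i => (e.symm i).1.1, fun i => (e.symm i).1.2, fun i => ?_, fun C hC => ?_⟩
  · obtain ⟨C, z, hz, hp⟩ := (e.symm i).2
    simp only [hp]
    exact ⟨hz.resetLower_nonempty, (hz.resetLower_subset hN).trans (hz.subset_resetUpper hN),
      hz.le_card_resetUpper⟩
  · obtain ⟨z, hz⟩ := hex C hC
    refine ⟨e ⟨_, C, z, hz, rfl⟩, ?_, fun j hj => ?_⟩
    · simp only [Equiv.symm_apply_apply]
      exact ⟨hz.resetLower_subset hN, hz.subset_resetUpper hN⟩
    · rw [← Equiv.symm_apply_eq]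
      obtain ⟨C', z', hz', hp⟩ := (e.symm j).2
      simp only [hp] at hj
      have hz'' := hz'.of_mem_interval hj.1 hj.2
      obtain ⟨i, hi⟩ := hC
      have heq : ∀ k ≤ 2 * (n / 2) + 1, z' k = z k := fun k hk =>
        hz''.eq (by omega) ((natIndicator_fin C i).2 hi) hz hk
      apply Subtype.ext
      rw [hp]
      refine Prod.ext ?_ ?_
      · refine Finset.filter_congr fun k _ => ?_
        rw [heq k (by omega), heq (k + 1) (by omega)]
      · refine Finset.filter_congr fun k _ => ?_
        rw [heq (k + 1) (by omega)]

/-! ### Retracts generated by indeterminates. -/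

variable {K : Type*} [Field K] {n : ℕ} {G : Type*} [AddCommGroup G]

open MvPolynomial

lemma aeval_mem_ringGrading (w : Fin n → G) {v : Fin n → MvPolynomial (Fin n) K}
    (hv : ∀ i, v i ∈ ringGrading K w (w i)) {g : G} {f : MvPolynomial (Fin n) K}
    (hf : f ∈ ringGrading K w g) : aeval v f ∈ ringGrading K w g := by
  rw [aeval_def, eval₂_eq']
  refine Submodule.sum_mem _ fun d hd => ?_
  have hd' : Finsupp.weight w d = g := hf (mem_support_iff.1 hd)
  have h : IsWeightedHomogeneous w (∏ i, v i ^ d i) (∑ i, d i • w i) :=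
    IsWeightedHomogeneous.prod _ _ _ fun i _ => (hv i).pow _
  have hsum : ∑ i, d i • w i = g := by
    rw [← hd', Finsupp.weight_apply, Finsupp.sum_fintype _ _ (by simp)]
  rw [hsum] at h
  exact h.C_mul _

/-- The subalgebra generated by a subset of the indeterminates is a graded retract. -/
lemma isGradedRetract_supported (w : Fin n → G) (B : Set (Fin n)) :
    IsGradedRetract w (supported K B) := by
  classical
  -- The retraction kills the indeterminates outside `B`; zero is homogeneous of every degree.
  let v : Fin n → supported K B := fun i => if h : i ∈ B then ⟨X i, X_mem_supported.2 h⟩ else 0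
  have hcoe : ∀ f, ((aeval v f : supported K B) : MvPolynomial (Fin n) K)
      = aeval (fun i => (v i : MvPolynomial (Fin n) K)) f := fun f => by
    have := comp_aeval_apply v (supported K B).val f
    simpa using this
  refine ⟨aeval v, fun g f hf => ?_, fun s => Subtype.ext ?_⟩
  · rw [hcoe]
    refine aeval_mem_ringGrading w (fun i => ?_) hf
    by_cases h : i ∈ B
    · simp only [v, h, dite_true]
      exact isWeightedHomogeneous_X K w i
    · simp [v, h]
  · rw [hcoe]
    obtain ⟨s, hs⟩ := s
    change aeval _ s = s
    refine Algebra.adjoin_induction ?_ (fun r => ?_) (fun x y _ _ hx hy => ?_)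
      (fun x y _ _ hx hy => ?_) hs
    · rintro _ ⟨i, hi, rfl⟩
      simp [v, hi]
    · simp [algebraMap_eq]
    · rw [map_add, hx, hy]
    · rw [map_mul, hx, hy]

lemma ringKrullDim_supported (B : Finset (Fin n)) :
    ringKrullDim (supported K (B : Set (Fin n))) = (B.card : WithBot ℕ∞) := by
  rw [ringKrullDim_eq_of_ringEquiv (supportedEquivMvPolynomial (B : Set (Fin n))).toRingEquiv,
    MvPolynomial.ringKrullDim_of_isNoetherianRing, ringKrullDim_eq_zero_of_field]
  simp

section CyclicPart

variable {M : Type*} [AddCommGroup M] [Module K M] [Module (MvPolynomial (Fin n) K) M]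
  [IsScalarTower K (MvPolynomial (Fin n) K) M]

lemma mem_cyclicPart {S : Subalgebra K (MvPolynomial (Fin n) K)} {x y : M} :
    y ∈ cyclicPart S x ↔ ∃ a ∈ S, a • x = y := by
  simp [cyclicPart]

end CyclicPart

/-! ### From interval partitions to Stanley decompositions. -/

/-- The exponent of the squarefree monomial with support `A`. -/
def squarefreeExponent (A : Finset (Fin n)) : Fin n →₀ ℕ :=
  Finsupp.equivFunOnFinite.symm fun i => if i ∈ A then 1 else 0

lemma squarefreeExponent_le_iff {A : Finset (Fin n)} {d : Fin n →₀ ℕ} :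
    squarefreeExponent A ≤ d ↔ A ⊆ d.support := by
  refine ⟨fun h i hi => ?_, fun h i => ?_⟩
  · have := h i
    simp only [squarefreeExponent, Finsupp.equivFunOnFinite_symm_apply_apply, hi, if_true] at this
    rw [Finsupp.mem_support_iff]
    omega
  · simp only [squarefreeExponent, Finsupp.equivFunOnFinite_symm_apply_apply]
    split_ifs with hi
    · exact Nat.one_le_iff_ne_zero.2 (Finsupp.mem_support_iff.1 (h hi))
    · exact Nat.zero_le _

lemma support_squarefreeExponent (A : Finset (Fin n)) : (squarefreeExponent A).support = A := by
  ext i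
  simp [squarefreeExponent]

lemma mem_maxIdeal_iff {f : MvPolynomial (Fin n) K} :
    f ∈ maxIdeal K n ↔ ∀ d ∈ f.support, d.support.Nonempty := by
  rw [maxIdeal, ← Set.image_univ, mem_ideal_span_X_image]
  simp [Finset.Nonempty]

lemma monomial_mem_maxIdeal {d : Fin n →₀ ℕ} (hd : d.support.Nonempty) (c : K) :
    monomial d c ∈ maxIdeal K n := by
  classical
  rw [mem_maxIdeal_iff]
  intro e he
  rw [Finset.mem_singleton.1 (support_monomial_subset he)]
  exact hd

/-- The exponents of the monomials in `X^A K[X_i : i ∈ B]`. -/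
def intervalExponents (A B : Finset (Fin n)) : Set (Fin n →₀ ℕ) :=
  {d | A ⊆ d.support ∧ d.support ⊆ B}

/-- The squarefree monomial with nonempty support `A`, as an element of `maxIdeal K n`. -/
def squarefreeMonomial (K : Type*) [Field K] (A : Finset (Fin n)) (hA : A.Nonempty) :
    maxIdeal K n :=
  ⟨monomial (squarefreeExponent A) 1,
    monomial_mem_maxIdeal (by rwa [support_squarefreeExponent]) 1⟩

lemma mem_cyclicPart_squarefreeMonomial {A B : Finset (Fin n)} (hA : A.Nonempty) (hAB : A ⊆ B)
    {y : maxIdeal K n} :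
    y ∈ cyclicPart (supported K (B : Set (Fin n))) (squarefreeMonomial K A hA) ↔
      (y : MvPolynomial (Fin n) K) ∈ restrictSupport K (intervalExponents A B) := by
  classical
  rw [mem_cyclicPart]
  constructor
  · rintro ⟨a, ha, rfl⟩
    rw [mem_restrictSupport_iff]
    intro d hd
    have hd' : coeff d (a * monomial (squarefreeExponent A) 1) ≠ 0 := mem_support_iff.1 hd
    rw [coeff_mul_monomial'] at hd'
    split_ifs at hd' with hle
    · refine ⟨squarefreeExponent_le_iff.1 hle, fun i hi => ?_⟩
      -- Outside `A` the exponent of `X i` comes entirely from `a`, whose variables lie in `B`.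
      by_cases hiA : i ∈ A
      · exact hAB hiA
      · rw [mul_one] at hd'
        rw [mem_supported] at ha
        refine ha ((mem_vars_iff_mem_support i).2 ⟨_, mem_support_iff.2 hd', ?_⟩)
        rw [Finsupp.mem_support_iff] at hi ⊢
        simpa [squarefreeExponent, hiA] using hi
    · exact absurd rfl hd'
  · intro hy
    suffices h : restrictSupport K (intervalExponents A B) ≤
        (cyclicPart (supported K (B : Set (Fin n))) (squarefreeMonomial K A hA)).map
          ((maxIdeal K n).subtype.restrictScalars K) by
      obtain ⟨z, hz, hzy⟩ := h hy
      rw [← mem_cyclicPart, ← Subtype.ext hzy]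
      exact hz
    rw [restrictSupport_eq_span, Submodule.span_le]
    rintro _ ⟨d, ⟨hAd, hdB⟩, rfl⟩
    have hle := squarefreeExponent_le_iff.2 hAd
    refine ⟨monomial (d - squarefreeExponent A) 1 • squarefreeMonomial K A hA,
      mem_cyclicPart.2 ⟨_, ?_, rfl⟩, ?_⟩
    · rw [mem_supported, vars_monomial one_ne_zero]
      intro i hi
      refine hdB ?_
      rw [Finset.mem_coe, Finsupp.mem_support_iff] at hi
      rw [Finsupp.mem_support_iff]
      intro h0
      simp [h0] at hi
    · change monomial (d - squarefreeExponent A) 1 * monomial (squarefreeExponent A) (1 : K) = _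
      rw [monomial_mul, tsub_add_cancel_of_le hle, one_mul]

/-- Each monomial of 𝔪 has its support in exactly one interval: uniqueness gives independence,
existence gives spanning. -/
lemma isInternal_cyclicPart_squarefreeMonomial {m : ℕ} {A B : Fin m → Finset (Fin n)}
    (hA : ∀ i, (A i).Nonempty) (hAB : ∀ i, A i ⊆ B i)
    (huniq : ∀ C : Finset (Fin n), C.Nonempty → ∃! i, A i ⊆ C ∧ C ⊆ B i) :
    DirectSum.IsInternal fun i =>
      cyclicPart (supported K (B i : Set (Fin n))) (squarefreeMonomial K (A i) (hA i)) := by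
  classical
  apply DirectSum.isInternal_submodule_of_iSupIndep_of_iSup_eq_top
  · intro i
    rw [Submodule.disjoint_def]
    intro y hy hy'
    rw [mem_cyclicPart_squarefreeMonomial (hA i) (hAB i), mem_restrictSupport_iff] at hy
    have hle : (⨆ j, ⨆ (_ : j ≠ i), cyclicPart (supported K (B j : Set (Fin n)))
        (squarefreeMonomial K (A j) (hA j))) ≤
        (restrictSupport K {d | ∃ j ≠ i, d ∈ intervalExponents (A j) (B j)}).comap
          ((maxIdeal K n).subtype.restrictScalars K) := by
      refine iSup₂_le fun j hj z hz => ?_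
      rw [mem_cyclicPart_squarefreeMonomial (hA j) (hAB j)] at hz
      refine restrictSupport_mono K (fun d hd => ?_) hz
      exact ⟨j, hj, hd⟩
    have hy'' := hle hy'
    rw [Submodule.mem_comap] at hy''
    refine Subtype.ext (support_eq_empty.1 (Finset.eq_empty_of_forall_notMem fun d hd => ?_))
    obtain ⟨j, hj, hdj⟩ := (mem_restrictSupport_iff K).1 hy'' hd
    exact hj ((huniq d.support (mem_maxIdeal_iff.1 y.2 d hd)).unique hdj (hy hd))
  · rw [eq_top_iff]
    rintro ⟨f, hf⟩ -
    have hsum : (⟨f, hf⟩ : maxIdeal K n) = ∑ d ∈ f.support.attach,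
        ⟨monomial d.1 (coeff d.1 f), monomial_mem_maxIdeal (mem_maxIdeal_iff.1 hf d.1 d.2) _⟩ := by
      apply Subtype.ext
      rw [AddSubmonoidClass.coe_finsetSum]
      refine f.as_sum.trans ?_
      exact (Finset.sum_attach _ fun d => monomial d (coeff d f)).symm
    rw [hsum]
    refine Submodule.sum_mem _ fun d _ => ?_
    obtain ⟨i, hi, -⟩ := huniq d.1.support (mem_maxIdeal_iff.1 hf d.1 d.2)
    refine Submodule.mem_iSup_of_mem i ?_
    rw [mem_cyclicPart_squarefreeMonomial (hA i) (hAB i), monomial_mem_restrictSupport]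
    exact Or.inl hi

/-- The Stanley decomposition of `𝔪` given by a partition of the nonempty subsets of `Fin n` into
intervals. -/
def stanleyDecompositionOfPartition (w : Fin n → G) {m : ℕ} (A B : Fin m → Finset (Fin n))
    (hA : ∀ i, (A i).Nonempty) (hAB : ∀ i, A i ⊆ B i)
    (huniq : ∀ C : Finset (Fin n), C.Nonempty → ∃! i, A i ⊆ C ∧ C ⊆ B i) :
    StanleyDecomposition w (idealGrading w (maxIdeal K n)) where
  size := m
  S i := supported K (B i : Set (Fin n))
  x i := squarefreeMonomial K (A i) (hA i)
  isGradedRetract i := isGradedRetract_supported w _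
  homogeneous i := ⟨_, isWeightedHomogeneous_monomial w (squarefreeExponent (A i)) 1 rfl⟩
  inter_ann i a _ h := by
    have h' : a * monomial (squarefreeExponent (A i)) 1 = 0 := congrArg Subtype.val h
    simpa using h'
  isInternal := isInternal_cyclicPart_squarefreeMonomial hA hAB huniq

theorem le_stanleyDepth_maxIdeal (w : Fin n → G) :
    (((n + 1) / 2 : ℕ) : WithBot ℕ∞) ≤ stanleyDepth w (idealGrading w (maxIdeal K n)) := by
  obtain ⟨m, A, B, h, huniq⟩ := exists_interval_partition n
  refine le_iSup_of_le (stanleyDecompositionOfPartition w A B (fun i => (h i).1)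
    (fun i => (h i).2.1) huniq) (le_iInf fun i => ?_)
  change _ ≤ ringKrullDim (supported K (B i : Set (Fin n)))
  rw [ringKrullDim_supported]
  exact_mod_cast (h i).2.2

/-! ### Homogeneous components and graded maps. -/

lemma component_of_mem (w : Fin n → G) {g h : G} {f : MvPolynomial (Fin n) K}
    (hf : f ∈ ringGrading K w h) [Decidable (g = h)] :
    weightedHomogeneousComponent w g f = if g = h then f else 0 := by
  classical
  rw [weightedHomogeneousComponent_of_mem hf]
  congr

/-- Checking on monomials suffices. It is applied to a retraction (`t = 0`) and to multiplication by
a homogeneous element. -/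
lemma component_map_eq_map_component {w : Fin n → G}
    {T : MvPolynomial (Fin n) K →ₗ[K] MvPolynomial (Fin n) K} {t : G}
    (hT : ∀ (g : G) (f : MvPolynomial (Fin n) K),
      f ∈ ringGrading K w g → T f ∈ ringGrading K w (g + t)) (g : G) (f : MvPolynomial (Fin n) K) :
    weightedHomogeneousComponent w g (T f) = T (weightedHomogeneousComponent w (g - t) f) := by
  classical
  suffices h : weightedHomogeneousComponent w g ∘ₗ T = T ∘ₗ weightedHomogeneousComponent w (g - t)
    from LinearMap.congr_fun h f
  ext d : 2
  change weightedHomogeneousComponent w g (T (monomial d 1)) =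
    T (weightedHomogeneousComponent w (g - t) (monomial d 1))
  have hd : (monomial d 1 : MvPolynomial (Fin n) K) ∈ ringGrading K w (Finsupp.weight w d) :=
    isWeightedHomogeneous_monomial w d 1 rfl
  rw [component_of_mem w hd, component_of_mem w (hT _ _ hd), sub_eq_iff_eq_add]
  split_ifs <;> simp

lemma IsGradedRetract.component_mem {w : Fin n → G} {S : Subalgebra K (MvPolynomial (Fin n) K)}
    (hS : IsGradedRetract w S) (g : G) {f : MvPolynomial (Fin n) K} (hf : f ∈ S) :
    weightedHomogeneousComponent w g f ∈ S := by
  obtain ⟨π, hπ, hid⟩ := hS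
  have h := component_map_eq_map_component (w := w) (t := 0)
    (T := S.val.toLinearMap ∘ₗ π.toLinearMap) (fun g f hf => by simpa using hπ g f hf) g f
  have hf' : (π f : MvPolynomial (Fin n) K) = f := congrArg Subtype.val (hid ⟨f, hf⟩)
  simp only [LinearMap.comp_apply, AlgHom.toLinearMap_apply, Subalgebra.coe_val, hf'] at h
  rw [h]
  exact (π _).2

lemma component_mul {w : Fin n → G} {s : G} {x : MvPolynomial (Fin n) K}
    (hx : x ∈ ringGrading K w s) (g : G) (f : MvPolynomial (Fin n) K) :
    weightedHomogeneousComponent w g (f * x) = weightedHomogeneousComponent w (g - s) f * x :=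
  component_map_eq_map_component (T := LinearMap.mulRight K x)
    (fun _ _ hf => IsWeightedHomogeneous.mul hf hx) g f

/-! ### Stanley decompositions induce Hilbert decompositions. -/

section ToHilbert

variable {w : Fin n → G} {I : Ideal (MvPolynomial (Fin n) K)}

/-- Multiplication with the generators identifies the product of the retracts of a Stanley
decomposition with the module. -/
lemma StanleyDecomposition.exists_equiv (D : StanleyDecomposition w (idealGrading w I)) :
    ∃ φ : I ≃ₗ[K] ⨁ i, D.S i, ∀ a : ⨁ i, D.S i,
      (φ.symm a : MvPolynomial (Fin n) K) =
        ∑ i, (a i : MvPolynomial (Fin n) K) * (D.x i : MvPolynomial (Fin n) K) := by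
  classical
  let L : ∀ i, D.S i →ₗ[K] cyclicPart (D.S i) (D.x i) := fun i =>
    { toFun := fun a => ⟨(a : MvPolynomial (Fin n) K) • D.x i, mem_cyclicPart.2 ⟨a, a.2, rfl⟩⟩
      map_add' := fun a b => Subtype.ext (add_smul _ _ _)
      map_smul' := fun c a => Subtype.ext (smul_assoc c (a : MvPolynomial (Fin n) K) (D.x i)) }
  have hL : ∀ i, Function.Bijective (L i) := fun i => by
    refine ⟨(injective_iff_map_eq_zero _).2 fun a ha => ?_, fun y => ?_⟩
    · exact Subtype.ext (D.inter_ann i a a.2 (congrArg Subtype.val ha))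
    · obtain ⟨a, ha, hy⟩ := mem_cyclicPart.1 y.2
      exact ⟨⟨a, ha⟩, Subtype.ext hy⟩
  let e := DFinsupp.mapRange.linearEquiv fun i => LinearEquiv.ofBijective (L i) (hL i)
  let c := LinearEquiv.ofBijective
    (DirectSum.coeLinearMap fun i => cyclicPart (D.S i) (D.x i)) D.isInternal
  refine ⟨(e.trans c).symm, fun a => ?_⟩
  have h : (e.trans c) a = ∑ i, (a i : MvPolynomial (Fin n) K) • D.x i := by
    change DirectSum.coeLinearMap (fun i => cyclicPart (D.S i) (D.x i)) (e a) = _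
    rw [DirectSum.coeLinearMap_eq_dfinsuppSum, DFinsupp.sum_eq_sum_fintype _ (by simp)]
    rfl
  rw [LinearEquiv.symm_symm, h]
  simp

/-- A Stanley decomposition of an ideal induces a Hilbert decomposition with the same retracts. -/
def StanleyDecomposition.toHilbertDecomposition
    (D : StanleyDecomposition w (idealGrading w I)) :
    HilbertDecomposition w (idealGrading w I) where
  size := D.size
  S := D.S
  s i := (D.homogeneous i).choose
  isGradedRetract := D.isGradedRetract
  exists_iso := by
    classical
    obtain ⟨φ, hφ⟩ := D.exists_equiv
    have hx : ∀ i, (D.x i : MvPolynomial (Fin n) K) ∈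
        ringGrading K w (D.homogeneous i).choose := fun i => (D.homogeneous i).choose_spec
    refine ⟨φ, fun g m => ?_⟩
    obtain ⟨a, rfl⟩ := φ.symm.surjective m
    rw [LinearEquiv.apply_symm_apply]
    change (φ.symm a : MvPolynomial (Fin n) K) ∈ ringGrading K w g ↔ _
    constructor
    · intro ha i
      -- Truncating each `a i` to its expected degree does not change `∑ a i * x i`, which is
      -- homogeneous of degree `g`; injectivity then gives `b = a`.
      let b : ⨁ i, D.S i := DFinsupp.equivFunOnFintype.symm fun i =>
        ⟨weightedHomogeneousComponent w (g - (D.homogeneous i).choose) (a i),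
          (D.isGradedRetract i).component_mem _ (a i).2⟩
      have hba : b = a := by
        refine φ.symm.injective (Subtype.ext ?_)
        rw [← weightedHomogeneousComponent_eq_self ha, hφ, hφ, map_sum]
        exact Finset.sum_congr rfl fun i _ => (component_mul (hx i) g _).symm
      rw [← hba]
      exact weightedHomogeneousComponent_mem w _ _
    · intro ha
      rw [hφ]
      refine Submodule.sum_mem _ fun i _ => ?_
      have h : _ ∈ ringGrading K w _ := IsWeightedHomogeneous.mul (ha i) (hx i)
      rwa [sub_add_cancel] at h

theorem stanleyDepth_le_hilbertDepth :
    stanleyDepth w (idealGrading w I) ≤ hilbertDepth w (idealGrading w I) :=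
  iSup_le fun D => le_iSup_of_le D.toHilbertDecomposition le_rfl

end ToHilbert

/-! ### Coarsening the grading. -/

section Coarsen

variable {G' : Type*} [AddCommGroup G'] {w : Fin n → G} (θ : G →+ G')

lemma weight_comp_eq_map_weight (w : Fin n → G) (d : Fin n →₀ ℕ) :
    Finsupp.weight (θ ∘ w) d = θ (Finsupp.weight w d) := by
  simp [Finsupp.weight_apply, Finsupp.sum, map_sum]

lemma ringGrading_le_coarsen {g : G} :
    ringGrading K w g ≤ ringGrading K (θ ∘ w) (θ g) := fun f hf d hd => by
  rw [weight_comp_eq_map_weight, hf hd]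

lemma component_eq_zero_of_coarsen {g : G} {g' : G'} (hg : θ g ≠ g')
    {f : MvPolynomial (Fin n) K} (hf : f ∈ ringGrading K (θ ∘ w) g') :
    weightedHomogeneousComponent w g f = 0 := by
  classical
  ext d
  rw [coeff_weightedHomogeneousComponent, coeff_zero]
  split_ifs with hd
  · by_contra h0
    refine hg ?_
    rw [← hf h0, weight_comp_eq_map_weight, hd]
  · rfl

/-- A coarsely homogeneous element is the sum of its fine components, and only those of degree over
`g'` are nonzero. -/
lemma mem_of_forall_component {g' : G'} {f : MvPolynomial (Fin n) K}
    (hf : f ∈ ringGrading K (θ ∘ w) g') {p : MvPolynomial (Fin n) K → Prop} (hzero : p 0)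
    (hadd : ∀ a b, p a → p b → p (a + b))
    (h : ∀ g, θ g = g' → p (weightedHomogeneousComponent w g f)) : p f := by
  rw [← finsum_weightedHomogeneousComponent w f]
  refine finsum_induction p hzero hadd fun g => ?_
  by_cases hg : θ g = g'
  · exact h g hg
  · rwa [component_eq_zero_of_coarsen θ hg hf]

lemma IsGradedRetract.coarsen {S : Subalgebra K (MvPolynomial (Fin n) K)}
    (hS : IsGradedRetract w S) : IsGradedRetract (θ ∘ w) S := by
  obtain ⟨π, hπ, hid⟩ := hS
  refine ⟨π, fun g' f hf => ?_, hid⟩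
  refine mem_of_forall_component θ hf (p := fun f =>
    (π f : MvPolynomial (Fin n) K) ∈ ringGrading K (θ ∘ w) g') (by simp) (fun a b ha hb => ?_)
    fun g hg => ?_
  · rw [map_add]
    exact Submodule.add_mem _ ha hb
  · rw [← hg]
    exact ringGrading_le_coarsen θ (hπ g _ (weightedHomogeneousComponent_mem w f g))

variable {I : Ideal (MvPolynomial (Fin n) K)}

/-- A Hilbert decomposition of a homogeneous ideal remains one for a coarser grading. -/
def HilbertDecomposition.coarsen
    (hI : ∀ f ∈ I, ∀ g, weightedHomogeneousComponent w g f ∈ I)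
    (D : HilbertDecomposition w (idealGrading w I)) :
    HilbertDecomposition (θ ∘ w) (idealGrading (θ ∘ w) I) where
  size := D.size
  S := D.S
  s i := θ (D.s i)
  isGradedRetract i := (D.isGradedRetract i).coarsen θ
  exists_iso := by
    classical
    obtain ⟨φ, hφ⟩ := D.exists_iso
    refine ⟨φ, fun g' m => ⟨fun hm => ?_, fun hm => ?_⟩⟩
    -- The existential makes the claim a predicate on polynomials, so that it can be checked on fine
    -- components.
    · have key : ∃ h : (m : MvPolynomial (Fin n) K) ∈ I, ∀ i,
          ((φ ⟨m, h⟩) i : MvPolynomial (Fin n) K) ∈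
            ringGrading K (θ ∘ w) (g' - θ (D.s i)) := by
        refine mem_of_forall_component θ hm (p := fun f => ∃ h : f ∈ I, ∀ i,
          ((φ ⟨f, h⟩) i : MvPolynomial (Fin n) K) ∈ ringGrading K (θ ∘ w) (g' - θ (D.s i)))
          ⟨I.zero_mem, fun i => ?_⟩ ?_ fun g hg => ⟨hI _ m.2 g, fun i => ?_⟩
        · have h0 : φ ⟨0, I.zero_mem⟩ = 0 := φ.map_zero
          rw [h0]
          exact Submodule.zero_mem _
        · rintro a b ⟨ha, ha'⟩ ⟨hb, hb'⟩
          refine ⟨I.add_mem ha hb, fun i => ?_⟩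
          have hab : φ ⟨a + b, I.add_mem ha hb⟩ = φ ⟨a, ha⟩ + φ ⟨b, hb⟩ :=
            φ.map_add ⟨a, ha⟩ ⟨b, hb⟩
          rw [hab]
          exact Submodule.add_mem _ (ha' i) (hb' i)
        · rw [← hg, ← map_sub]
          exact ringGrading_le_coarsen θ
            ((hφ g ⟨_, hI _ m.2 g⟩).1 (weightedHomogeneousComponent_mem w _ g) i)
      exact key.2
    · obtain ⟨a, rfl⟩ := φ.symm.surjective m
      simp only [LinearEquiv.apply_symm_apply] at hm
      have hsum : a = ∑ i, DirectSum.lof K _ (fun i => D.S i) i (a i) :=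
        (DirectSum.sum_univ_of a).symm
      rw [hsum, map_sum]
      refine Submodule.sum_mem _ fun i _ => ?_
      have key : ∃ h : (a i : MvPolynomial (Fin n) K) ∈ D.S i,
          φ.symm (DirectSum.lof K _ (fun i => D.S i) i ⟨a i, h⟩) ∈
            idealGrading (θ ∘ w) I g' := by
        refine mem_of_forall_component θ (hm i) (p := fun f => ∃ h : f ∈ D.S i,
          φ.symm (DirectSum.lof K _ (fun i => D.S i) i ⟨f, h⟩) ∈ idealGrading (θ ∘ w) I g')
          ⟨(D.S i).zero_mem, ?_⟩ ?_ fun g hg =>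
            ⟨(D.isGradedRetract i).component_mem g (a i).2, ?_⟩
        · have h0 : (⟨0, (D.S i).zero_mem⟩ : D.S i) = 0 := rfl
          rw [h0, map_zero, map_zero]
          exact Submodule.zero_mem _
        · rintro b c ⟨hb, hb'⟩ ⟨hc, hc'⟩
          refine ⟨(D.S i).add_mem hb hc, ?_⟩
          have hbc : (⟨b + c, (D.S i).add_mem hb hc⟩ : D.S i) = ⟨b, hb⟩ + ⟨c, hc⟩ := rfl
          rw [hbc, map_add, map_add]
          exact Submodule.add_mem _ hb' hc'
        · have hmem : φ.symm (DirectSum.lof K _ (fun i => D.S i) i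
              ⟨_, (D.isGradedRetract i).component_mem g (a i).2⟩) ∈
                idealGrading w I (g + D.s i) := by
            rw [hφ]
            intro j
            rw [LinearEquiv.apply_symm_apply]
            by_cases hj : j = i
            · subst hj
              rw [DirectSum.lof_apply, add_sub_cancel_right]
              exact weightedHomogeneousComponent_mem w _ g
            · rw [DirectSum.lof_eq_of, DirectSum.of_eq_of_ne _ _ _ hj]
              exact Submodule.zero_mem _
          have h := ringGrading_le_coarsen (K := K) (w := w) θ hmem
          rwa [map_add, hg, sub_add_cancel] at h
      exact key.2

theorem hilbertDepth_le_hilbertDepth_coarsen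
    (hI : ∀ f ∈ I, ∀ g, weightedHomogeneousComponent w g f ∈ I) :
    hilbertDepth w (idealGrading w I) ≤ hilbertDepth (θ ∘ w) (idealGrading (θ ∘ w) I) :=
  iSup_le fun D => le_iSup_of_le (D.coarsen θ hI) le_rfl

end Coarsen

lemma component_mem_maxIdeal (w : Fin n → G) {f : MvPolynomial (Fin n) K}
    (hf : f ∈ maxIdeal K n) (g : G) : weightedHomogeneousComponent w g f ∈ maxIdeal K n := by
  classical
  rw [mem_maxIdeal_iff] at hf ⊢
  intro d hd
  rw [support_weightedHomogeneousComponent] at hd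
  exact hf d (Finset.mem_filter.1 hd).1

lemma sum_comp_multiDegree (n : ℕ) :
    ⇑(∑ i, Pi.evalAddMonoidHom (fun _ : Fin n => ℤ) i : (Fin n → ℤ) →+ ℤ) ∘ multiDegree n = standardDegree n := by
  ext i
  simp [multiDegree, standardDegree]

theorem hilbertDepth_multiDegree_le_standardDegree :
    hilbertDepth (multiDegree n) (idealGrading (multiDegree n) (maxIdeal K n)) ≤
      hilbertDepth (standardDegree n) (idealGrading (standardDegree n) (maxIdeal K n)) := by
  have h := hilbertDepth_le_hilbertDepth_coarsen (w := multiDegree n) (I := maxIdeal K n)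
    (∑ i, Pi.evalAddMonoidHom (fun _ : Fin n => ℤ) i) fun _ hf g => component_mem_maxIdeal _ hf g
  rwa [sum_comp_multiDegree] at h

/-! ### Low degrees of the standard grading. -/

lemma weight_standardDegree (d : Fin n →₀ ℕ) :
    Finsupp.weight (standardDegree n) d = ((∑ i, d i : ℕ) : ℤ) := by
  simp [Finsupp.weight_apply, Finsupp.sum_fintype, standardDegree]

lemma ringGrading_standardDegree (k : ℕ) :
    ringGrading K (standardDegree n) k =
      restrictSupport K ((Finset.finsuppAntidiag (Finset.univ : Finset (Fin n)) k :
        Finset (Fin n →₀ ℕ)) : Set (Fin n →₀ ℕ)) := by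
  ext f
  rw [mem_restrictSupport_iff]
  refine ⟨fun hf d hd => ?_, fun hf d hd => ?_⟩
  · have h := hf (mem_support_iff.1 hd)
    rw [weight_standardDegree] at h
    simpa using (Int.ofNat_inj.1 h : ∑ i, d i = k)
  · have h := hf (mem_support_iff.2 hd)
    rw [weight_standardDegree]
    exact congrArg _ (Finset.mem_finsuppAntidiag.1 h).1

instance finite_ringGrading_standardDegree (k : ℕ) :
    Module.Finite K (ringGrading K (standardDegree n) k) := by
  rw [ringGrading_standardDegree]
  exact Module.Finite.of_basis (basisRestrictSupport K _)

lemma finrank_ringGrading_standardDegree (k : ℕ) :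
    Module.finrank K (ringGrading K (standardDegree n) k) = (n + k - 1).choose k := by
  rw [ringGrading_standardDegree, Module.finrank_eq_nat_card_basis (basisRestrictSupport K _),
    Nat.card_coe_set_eq, Set.ncard_coe_finset, Finset.card_finsuppAntidiag_nat_eq_choose,
    Finset.card_univ, Fintype.card_fin]

lemma eq_zero_of_mem_ringGrading_of_neg {g : ℤ} (hg : g < 0) {f : MvPolynomial (Fin n) K}
    (hf : f ∈ ringGrading K (standardDegree n) g) : f = 0 := by
  ext d
  by_contra h
  have hd := hf h
  rw [weight_standardDegree] at hd
  omega

lemma eq_C_of_mem_ringGrading_zero {f : MvPolynomial (Fin n) K}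
    (hf : f ∈ ringGrading K (standardDegree n) 0) : f = C (coeff 0 f) := by
  ext d
  rw [coeff_C]
  split_ifs with h
  · rw [h]
  · by_contra h0
    have hd := hf h0
    rw [weight_standardDegree] at hd
    refine h (Finsupp.ext fun i => ?_)
    have := (Finset.sum_eq_zero_iff (s := Finset.univ) (f := fun i => d i)).1
      (by exact_mod_cast hd) i (Finset.mem_univ i)
    simpa using this.symm

lemma eq_zero_of_mem_maxIdeal_of_nonpos {g : ℤ} (hg : g ≤ 0) {f : MvPolynomial (Fin n) K}
    (hm : f ∈ maxIdeal K n) (hf : f ∈ ringGrading K (standardDegree n) g) : f = 0 := by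
  ext d
  by_contra h
  obtain ⟨i, hi⟩ := mem_maxIdeal_iff.1 hm d (mem_support_iff.2 h)
  have hd := hf h
  rw [weight_standardDegree] at hd
  have := Finset.single_le_sum (f := fun i => d i) (fun i _ => Nat.zero_le _) (Finset.mem_univ i)
  have := Finsupp.mem_support_iff.1 hi
  omega

/-- The space of linear forms in a subalgebra. -/
def linearForms (S : Subalgebra K (MvPolynomial (Fin n) K)) :
    Submodule K (MvPolynomial (Fin n) K) :=
  Subalgebra.toSubmodule S ⊓ ringGrading K (standardDegree n) (1 : ℕ)

instance finite_linearForms (S : Subalgebra K (MvPolynomial (Fin n) K)) :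
    Module.Finite K (linearForms S) :=
  Submodule.finiteDimensional_inf_right _ _

/-- A graded retract is generated by its linear forms. -/
lemma IsGradedRetract.ringKrullDim_le {S : Subalgebra K (MvPolynomial (Fin n) K)}
    (hS : IsGradedRetract (standardDegree n) S) :
    ringKrullDim S ≤ (Module.finrank K (linearForms S) : WithBot ℕ∞) := by
  obtain ⟨π, hπ, hid⟩ := hS
  let b := Module.finBasis K (linearForms S)
  let ι : linearForms S →ₗ[K] S := Submodule.inclusion inf_le_left
  let F : MvPolynomial (Fin (Module.finrank K (linearForms S))) K →ₐ[K] S :=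
    aeval fun k => ι (b k)
  -- Degree preservation makes `π (X j)` a linear form in `S`; since `π` is onto, these images
  -- generate `S`.
  have hX : ∀ j, π (X j) ∈ F.range := fun j => by
    have hmem : (π (X j) : MvPolynomial (Fin n) K) ∈ linearForms S :=
      ⟨(π (X j)).2, hπ _ _ (isWeightedHomogeneous_X K (standardDegree n) j)⟩
    have hι : π (X j) = ι ⟨_, hmem⟩ := rfl
    rw [hι, ← b.sum_repr ⟨_, hmem⟩, map_sum]
    refine Subalgebra.sum_mem _ fun k _ => ?_
    rw [map_smul]
    exact Subalgebra.smul_mem _ (F.mem_range.2 ⟨X k, aeval_X _ _⟩) _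
  have hF : Function.Surjective F := fun s => by
    rw [← AlgHom.mem_range, ← hid s]
    generalize (s : MvPolynomial (Fin n) K) = f
    induction f using MvPolynomial.induction_on with
    | C a =>
      rw [← algebraMap_eq, AlgHom.commutes]
      exact Subalgebra.algebraMap_mem _ a
    | add p q hp hq =>
      rw [map_add]
      exact Subalgebra.add_mem _ hp hq
    | mul_X p j hp =>
      rw [map_mul]
      exact Subalgebra.mul_mem _ hp (hX j)
  refine (ringKrullDim_le_of_surjective F.toRingHom hF).trans ?_
  rw [MvPolynomial.ringKrullDim_of_isNoetherianRing, ringKrullDim_eq_zero_of_field]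
  simp

/-! ### The upper bound by counting in degrees 1 and 2. -/

section Counting

variable (D : HilbertDecomposition (standardDegree n)
  (idealGrading (standardDegree n) (maxIdeal K n)))

/-- The unit of `S i` yields a nonzero element of 𝔪 of degree `s i`, and 𝔪 vanishes in degrees at
most 0. -/
lemma HilbertDecomposition.one_le_shift (i : Fin D.size) : 1 ≤ D.s i := by
  classical
  obtain ⟨φ, hφ⟩ := D.exists_iso
  by_contra hlt
  have hmem : φ.symm (DirectSum.lof K _ (fun i => D.S i) i 1) ∈
      idealGrading (standardDegree n) (maxIdeal K n) (D.s i) := by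
    rw [hφ]
    intro j
    rw [LinearEquiv.apply_symm_apply]
    by_cases hj : j = i
    · subst hj
      rw [DirectSum.lof_apply, sub_self]
      exact isWeightedHomogeneous_one K _
    · rw [DirectSum.lof_eq_of, DirectSum.of_eq_of_ne _ _ _ hj]
      exact Submodule.zero_mem _
  have h0 : φ.symm (DirectSum.lof K _ (fun i => D.S i) i 1) = 0 :=
    Subtype.ext (eq_zero_of_mem_maxIdeal_of_nonpos (by omega) (Subtype.prop _) hmem)
  rw [LinearEquiv.map_eq_zero_iff] at h0
  have h1 := DirectSum.lof_apply K i (M := fun i => D.S i) 1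
  rw [h0] at h1
  exact zero_ne_one h1

/-- A summand with shift 1 contributes only constants; a larger shift would need elements of
negative degree. -/
lemma HilbertDecomposition.mem_span_of_mem_degree_one {a : ⨁ i, D.S i}
    (ha : ∀ i, (a i : MvPolynomial (Fin n) K) ∈ ringGrading K (standardDegree n) (1 - D.s i)) :
    a ∈ Submodule.span K (Set.range fun i : {i // D.s i = 1} =>
      DirectSum.lof K _ (fun i => D.S i) i.1 1) := by
  classical
  have hsum : a = ∑ i, DirectSum.lof K _ (fun i => D.S i) i (a i) :=
    (DirectSum.sum_univ_of a).symm
  rw [hsum]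
  refine Submodule.sum_mem _ fun i _ => ?_
  have hi := ha i
  rcases (D.one_le_shift i).eq_or_lt with h | h
  · rw [← h, sub_self] at hi
    have hc : a i = coeff 0 (a i : MvPolynomial (Fin n) K) • (1 : D.S i) := by
      refine Subtype.ext ((eq_C_of_mem_ringGrading_zero hi).trans ?_)
      rw [← algebraMap_eq, Algebra.algebraMap_eq_smul_one]
      rfl
    rw [hc, map_smul]
    exact Submodule.smul_mem _ _ (Submodule.subset_span ⟨⟨i, h.symm⟩, rfl⟩)
  · have hz : a i = 0 := Subtype.ext (eq_zero_of_mem_ringGrading_of_neg (by omega) hi)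
    rw [hz, map_zero]
    exact Submodule.zero_mem _

lemma linearIndependent_X_maxIdeal :
    LinearIndependent K fun j : Fin n =>
      (⟨X j, Ideal.subset_span ⟨j, rfl⟩⟩ : maxIdeal K n) :=
  LinearIndependent.of_comp ((maxIdeal K n).subtype.restrictScalars K)
    (linearIndependent_X (Fin n) K)

lemma HilbertDecomposition.le_card_shift_eq_one :
    n ≤ Fintype.card {i // D.s i = 1} := by
  classical
  obtain ⟨φ, hφ⟩ := D.exists_iso
  have hle := linearIndependent_le_span' _ (linearIndependent_X_maxIdeal (K := K) (n := n))
    (Set.range fun i : {i // D.s i = 1} => φ.symm (DirectSum.lof K _ (fun i => D.S i) i.1 1)) (by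
      rintro _ ⟨j, rfl⟩
      have h := Submodule.apply_mem_span_image_of_mem_span φ.symm.toLinearMap
        (D.mem_span_of_mem_degree_one
          ((hφ 1 ⟨X j, Ideal.subset_span ⟨j, rfl⟩⟩).1
            (isWeightedHomogeneous_X K (standardDegree n) j)))
      rw [← Set.range_comp] at h
      simp only [LinearEquiv.coe_coe, LinearEquiv.symm_apply_apply] at h
      exact h)
  rw [Cardinal.mk_fin, Nat.cast_le] at hle
  exact hle.trans (Fintype.card_range_le _)

/-- Linear forms in summands with shift 1 land in degree 2 of 𝔪, and jointly they embed in `R_2`. -/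
lemma HilbertDecomposition.sum_finrank_linearForms_le :
    ∑ i : {i // D.s i = 1}, Module.finrank K (linearForms (D.S i)) ≤ (n + 1).choose 2 := by
  classical
  obtain ⟨φ, hφ⟩ := D.exists_iso
  let J := {i // D.s i = 1}
  let ι : ∀ i, linearForms (D.S i) →ₗ[K] D.S i := fun i => Submodule.inclusion inf_le_left
  let T : (∀ i : J, linearForms (D.S i)) →ₗ[K] ∀ i, D.S i := LinearMap.pi fun i =>
    if h : D.s i = 1 then ι i ∘ₗ LinearMap.proj (⟨i, h⟩ : J) else 0
  let Φ : (∀ i, D.S i) ≃ₗ[K] maxIdeal K n :=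
    (DirectSum.linearEquivFunOnFintype K (Fin D.size) fun i => D.S i).symm.trans φ.symm
  have hT : ∀ v, ((Φ (T v) : maxIdeal K n) : MvPolynomial (Fin n) K) ∈
      ringGrading K (standardDegree n) (2 : ℕ) := fun v => by
    refine (hφ ((2 : ℕ) : ℤ) (Φ (T v))).2 fun i => ?_
    have hi : φ (Φ (T v)) i = T v i := by
      simp only [Φ, LinearEquiv.trans_apply, LinearEquiv.apply_symm_apply]
      rfl
    rw [hi]
    by_cases h : D.s i = 1
    · have hv : T v i = ι i (v ⟨i, h⟩) := by simp [T, h]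
      rw [hv, h]
      exact (v ⟨i, h⟩).2.2
    · have hv : T v i = 0 := by simp [T, h]
      rw [hv]
      exact Submodule.zero_mem _
  have hinj : Function.Injective T := fun v v' h => by
    funext i
    have hi := congrFun h i.1
    have hv : ∀ v, T v i.1 = ι i.1 (v i) := fun v => by
      simp only [T, LinearMap.pi_apply, i.2, dite_true]
      rfl
    rw [hv, hv] at hi
    exact Submodule.inclusion_injective _ hi
  let L : (∀ i : J, linearForms (D.S i)) →ₗ[K] ringGrading K (standardDegree n) (2 : ℕ) :=
    LinearMap.codRestrict _
      ((maxIdeal K n).subtype.restrictScalars K ∘ₗ Φ.toLinearMap ∘ₗ T) hT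
  have hL : Function.Injective L := fun v v' h => by
    have h' := congrArg Subtype.val h
    exact hinj (Φ.injective (Subtype.ext h'))
  have h := LinearMap.finrank_le_finrank_of_injective hL
  rwa [Module.finrank_pi_fintype, finrank_ringGrading_standardDegree] at h

theorem HilbertDecomposition.depth_le (hn : 1 ≤ n) :
    D.depth ≤ (((n + 1) / 2 : ℕ) : WithBot ℕ∞) := by
  obtain ⟨i, hi⟩ : ∃ i : {i // D.s i = 1},
      Module.finrank K (linearForms (D.S i)) ≤ (n + 1) / 2 := by
    -- Averaging: otherwise at least `n` summands would each have more than `(n + 1) / 2` linear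
    -- forms, exceeding the total `n (n + 1) / 2`.
    by_contra! hlt
    have h1 := D.sum_finrank_linearForms_le
    have h2 := Finset.card_nsmul_le_sum (Finset.univ : Finset {i // D.s i = 1})
      (fun i => Module.finrank K (linearForms (D.S i))) ((n + 1) / 2 + 1) fun i _ => hlt i
    have h3 := D.le_card_shift_eq_one
    rw [Finset.card_univ, smul_eq_mul] at h2
    have h4 := (Nat.mul_le_mul_right ((n + 1) / 2 + 1) h3).trans (h2.trans h1)
    rw [Nat.choose_two_right, Nat.add_sub_cancel] at h4
    have h5 : (n + 1) < 2 * ((n + 1) / 2 + 1) := by omega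
    have h6 : n * (n + 1) < n * (2 * ((n + 1) / 2 + 1)) := Nat.mul_lt_mul_of_pos_left h5 hn
    have h7 := Nat.div_mul_le_self ((n + 1) * n) 2
    nlinarith
  refine (iInf_le _ i.1).trans (((D.isGradedRetract i.1).ringKrullDim_le).trans ?_)
  exact_mod_cast hi

end Counting

theorem hilbertDepth_standardDegree_le (hn : 1 ≤ n) :
    hilbertDepth (standardDegree n) (idealGrading (standardDegree n) (maxIdeal K n)) ≤
      (((n + 1) / 2 : ℕ) : WithBot ℕ∞) :=
  iSup_le fun D => D.depth_le hn

end StanleyHilbert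

end

theorem theorem3p1 (K : Type*) [Field K] (n : ℕ) (hn : 1 ≤ n) :
    StanleyHilbert.hilbertDepth (StanleyHilbert.standardDegree n)
        (StanleyHilbert.idealGrading (StanleyHilbert.standardDegree n)
          (StanleyHilbert.maxIdeal K n)) = (((n + 1) / 2 : ℕ) : WithBot ℕ∞) ∧
    StanleyHilbert.hilbertDepth (StanleyHilbert.multiDegree n)
        (StanleyHilbert.idealGrading (StanleyHilbert.multiDegree n)
          (StanleyHilbert.maxIdeal K n)) = (((n + 1) / 2 : ℕ) : WithBot ℕ∞) ∧
    StanleyHilbert.stanleyDepth (StanleyHilbert.multiDegree n)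
        (StanleyHilbert.idealGrading (StanleyHilbert.multiDegree n)
          (StanleyHilbert.maxIdeal K n)) = (((n + 1) / 2 : ℕ) : WithBot ℕ∞) := by
  have h₁ := StanleyHilbert.hilbertDepth_standardDegree_le (K := K) hn
  have h₂ := StanleyHilbert.hilbertDepth_multiDegree_le_standardDegree (K := K) (n := n)
  have h₃ := StanleyHilbert.stanleyDepth_le_hilbertDepth (w := StanleyHilbert.multiDegree n)
    (I := StanleyHilbert.maxIdeal K n)
  have h₄ := StanleyHilbert.le_stanleyDepth_maxIdeal (K := K) (StanleyHilbert.multiDegree n)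
  exact ⟨le_antisymm h₁ (h₄.trans (h₃.trans h₂)), le_antisymm (h₂.trans h₁) (h₄.trans h₃),
    le_antisymm (h₃.trans (h₂.trans h₁)) h₄⟩
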